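/- Let $n,k\ge 0$ be integers. A permutation $\sigma=\sigma_1\cdots\sigma_{2n+1}$ of $\{1,\dots,2n+1\}$, with the convention $\sigma_0=\sigma_{2n+2}=0$, is called an $\mathcal F$-permutation if (i) every descent $\sigma_i>\sigma_{i+1}$ ($1\le i\le 2n$) is odd-odd, i.e. $\sigma_i$ and $\sigma_{i+1}$ are both odd; (ii) $\sigma_{2n+1}$ is odd and $\sigma_{2n}<\sigma_{2n+1}$; (iii) $\sigma$ has no double descent, i.e. there is no $i\in\{1,\dots,2n+1\}$ with $\sigma_{i-1}>\sigma_i>\sigma_{i+1}$. Let $\overline{\mathcal Y}^*_{2n+1,k}$ be the set of $\mathcal F$-permutations of $\{1,\dots,2n+1\}$ with exactly $k$ descents. Let $\operatorname{lema}\sigma$ be the number of even left-to-right maxima of $\sigma$, let $\operatorname{res}\sigma$ be the number of pairs $1\le i<j\le 2n$ with $\sigma_{j+1}>\sigma_i>\sigma_j$, and let $\operatorname{les}\sigma$ be the number of pairs $2\le i<j\le 2n+1$ with $\sigma_{i-1}>\sigma_j>\sigma_i$. For a value $x$, let $\operatorname{les}_\sigma(x)$ be the number of the latter pairs with $\sigma_j=x$.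 The $\gamma$-coefficients of the odd-odd model are $$\gamma_{n,k}(a,p,q)=\sum_{\sigma\in\overline{\mathcal Y}^*_{2n+1,k}}a^{\operatorname{lema}\sigma}p^{\operatorname{res}\sigma}q^{\operatorname{les}\sigma}.$$ The value $\sigma_i$ is a peak if $\sigma_{i-1}<\sigma_i>\sigma_{i+1}$ and a valley if $\sigma_{i-1}>\sigma_i<\sigma_{i+1}$. Put $a_\sigma(j)=f(j)-g(j)+1$, where $f(j)$ and $g(j)$ are the numbers of valleys and of peaks of $\sigma$ that are less than $j$. For $1\le i\le n$, the pair $x=\{2i-1,2i\}$ is a VOP pair of $\sigma$ if $2i-1$ is a valley or a peak of $\sigma$; its embracing number is $l_\sigma(x)=\operatorname{les}_\sigma(2i-1)$ if $a_\sigma(2i-1)$ is even and $l_\sigma(x)=\operatorname{les}_\sigma(2i)$ if $a_\sigma(2i-1)$ is odd. An $\mathcal F$-permutation is normalized if $l_\sigma(x)$ is even for every VOP pair $x$ of $\sigma$. Let $\widehat{\mathcal Y}^*_{2n+1,k}$ be the set of normalized $\mathcal F$-permutations of $\{1,\dots,2n+1\}$ with exactly $k$ descents. Theorem. Every $\sigma\in\widehat{\mathcal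 Y}^*_{2n+1,k}$ satisfies $\operatorname{res}\sigma\ge 2k$, and $$\gamma_{n,k}(1,p,q)=(p+q)^{2k}\sum_{\sigma\in\widehat{\mathcal Y}^*_{2n+1,k}}p^{\operatorname{res}\sigma-2k}\,q^{\operatorname{les}\sigma}$$ as polynomials in $p,q$ (equivalently, for all elements $p,q$ of every commutative semiring). -/

import Mathlib

namespace OddOdd

open Finset

/-- The word `σ₁ σ₂ … σ_m` of a permutation of `{1, …, m}` (a permutation of `Fin m` with all
positions and values shifted by one), with the convention `σ₀ = σ_{m+1} = 0`. -/
def entry {m : ℕ} (σ : Equiv.Perm (Fin m)) (i : ℕ) : ℕ :=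
  if h : 1 ≤ i ∧ i ≤ m then (σ ⟨i - 1, by omega⟩ : ℕ) + 1 else 0

/-- Positions `i` with `1 ≤ i < m` and `σ_i > σ_{i+1}`. -/
def descents {m : ℕ} (σ : Equiv.Perm (Fin m)) : Finset ℕ :=
  (Ico 1 m).filter fun i => entry σ i > entry σ (i + 1)

def des {m : ℕ} (σ : Equiv.Perm (Fin m)) : ℕ := (descents σ).card

/-- Pairs `(i, j)` with `2 ≤ i < j ≤ m` and `σ_{i-1} > σ_j > σ_i`. -/
def lesPairs {m : ℕ} (σ : Equiv.Perm (Fin m)) : Finset (ℕ × ℕ) :=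
  (Icc 2 m ×ˢ Icc 2 m).filter fun z =>
    z.1 < z.2 ∧ entry σ (z.1 - 1) > entry σ z.2 ∧ entry σ z.2 > entry σ z.1

def les {m : ℕ} (σ : Equiv.Perm (Fin m)) : ℕ := (lesPairs σ).card

/-- The number of left-embracings of the value `x`: pairs `(i, j)` counted by `les` with
`σ_j = x`. -/
def leftEmbracings {m : ℕ} (σ : Equiv.Perm (Fin m)) (x : ℕ) : ℕ :=
  ((lesPairs σ).filter fun z => entry σ z.2 = x).card

/-- The number of pairs `(i, j)` with `1 ≤ i < j ≤ m - 1` and `σ_{j+1} > σ_i > σ_j`. -/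
def res {m : ℕ} (σ : Equiv.Perm (Fin m)) : ℕ :=
  ((Ico 1 m ×ˢ Ico 1 m).filter fun z =>
    z.1 < z.2 ∧ entry σ (z.2 + 1) > entry σ z.1 ∧ entry σ z.1 > entry σ z.2).card

/-- The number of even left-to-right maxima. -/
def lema {m : ℕ} (σ : Equiv.Perm (Fin m)) : ℕ :=
  ((Icc 1 m).filter fun j =>
    Even (entry σ j) ∧ ∀ i < j, 1 ≤ i → entry σ i < entry σ j).card

/-- The set of values `σ_i` with `σ_{i-1} < σ_i > σ_{i+1}`. -/
def peaks {m : ℕ} (σ : Equiv.Perm (Fin m)) : Finset ℕ :=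
  ((Icc 1 m).filter fun i =>
    entry σ (i - 1) < entry σ i ∧ entry σ i > entry σ (i + 1)).image (entry σ)

/-- The set of values `σ_i` with `σ_{i-1} > σ_i < σ_{i+1}`. -/
def valleys {m : ℕ} (σ : Equiv.Perm (Fin m)) : Finset ℕ :=
  ((Icc 1 m).filter fun i =>
    entry σ (i - 1) > entry σ i ∧ entry σ i < entry σ (i + 1)).image (entry σ)

/-- The set of values `σ_i` with `σ_{i-1} > σ_i > σ_{i+1}`. -/
def doubleDescents {m : ℕ} (σ : Equiv.Perm (Fin m)) : Finset ℕ :=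
  ((Icc 1 m).filter fun i =>
    entry σ (i - 1) > entry σ i ∧ entry σ i > entry σ (i + 1)).image (entry σ)

/-- All descents of `σ` are odd-odd, and `σ` ends with an odd entry. -/
def IsOddOddEndingOdd (n : ℕ) (σ : Equiv.Perm (Fin (2 * n + 1))) : Prop :=
  (∀ i ∈ descents σ, Odd (entry σ i) ∧ Odd (entry σ (i + 1))) ∧ Odd (entry σ (2 * n + 1))

instance (n : ℕ) : DecidablePred (IsOddOddEndingOdd n) := fun σ => by
  unfold IsOddOddEndingOdd; infer_instance

/-- `F`-permutations. -/
def IsF (n : ℕ) (σ : Equiv.Perm (Fin (2 * n + 1))) : Prop :=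
  IsOddOddEndingOdd n σ ∧ doubleDescents σ = ∅ ∧ entry σ (2 * n) < entry σ (2 * n + 1)

instance (n : ℕ) : DecidablePred (IsF n) := fun σ => by
  unfold IsF; infer_instance

/-- `a(j) = f(j) - g(j) + 1`, where `f(j)` and `g(j)` are the numbers of valleys and of peaks
less than `j`. -/
def height {m : ℕ} (σ : Equiv.Perm (Fin m)) (j : ℕ) : ℤ :=
  (((valleys σ).filter (· < j)).card : ℤ) - (((peaks σ).filter (· < j)).card : ℤ) + 1

/-- `{2i-1, 2i}` is a VOP pair: `2i-1` is a valley or a peak. -/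
def IsVOP {m : ℕ} (σ : Equiv.Perm (Fin m)) (i : ℕ) : Prop :=
  2 * i - 1 ∈ valleys σ ∨ 2 * i - 1 ∈ peaks σ

instance {m : ℕ} (σ : Equiv.Perm (Fin m)) : DecidablePred (IsVOP σ) := fun i => by
  unfold IsVOP; infer_instance

/-- The embracing number of the pair `{2i-1, 2i}`. -/
def pairEmbracing {m : ℕ} (σ : Equiv.Perm (Fin m)) (i : ℕ) : ℕ :=
  if Even (height σ (2 * i - 1)) then leftEmbracings σ (2 * i - 1) else leftEmbracings σ (2 * i)

/-- Normalized `F`-permutations. -/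
def IsNormalizedF (n : ℕ) (σ : Equiv.Perm (Fin (2 * n + 1))) : Prop :=
  IsF n σ ∧ ∀ i ∈ Icc 1 n, IsVOP σ i → Even (pairEmbracing σ i)

instance (n : ℕ) : DecidablePred (IsNormalizedF n) := fun σ => by
  unfold IsNormalizedF; infer_instance

/-- `F`-permutations of `{1, …, 2n+1}` with `k` descents. -/
def FPerms (n k : ℕ) : Finset (Equiv.Perm (Fin (2 * n + 1))) :=
  univ.filter fun σ => IsF n σ ∧ des σ = k

/-- Normalized `F`-permutations of `{1, …, 2n+1}` with `k` descents. -/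
def normalizedFPerms (n k : ℕ) : Finset (Equiv.Perm (Fin (2 * n + 1))) :=
  univ.filter fun σ => IsNormalizedF n σ ∧ des σ = k

/-- The coefficient `γ_{n,k}(a, p, q)`, evaluated at elements of a commutative semiring. -/
def gammaCoeff {R : Type*} [CommSemiring R] (n k : ℕ) (a p q : R) : R :=
  ∑ σ ∈ FPerms n k, a ^ lema σ * p ^ res σ * q ^ les σ

end OddOdd

/-!
Group the permutations by shape, that is, by their sets of valleys, of peaks and of double descents.
A permutation is built by inserting `1, 2, …, m` in turn into the gaps of an open word
(Françon–Viennot). The shape prescribes on which sides of the inserted letter `x` a gap remains,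
while the choice among the `height x` available gaps is free: the gaps to the left of `x` become
the left-embracings of `x`, counted by `les`, and those to the right become its right-embracings,
counted by `res`. Hence `leftEmbracings` maps a shape class bijectively onto the product of the
ranges `{0, …, height x - 1}`, and the sum of `p ^ res * q ^ les` over the class is the product over
`x` of `∑ l < height x, p ^ (height x - 1 - l) * q ^ l`. When `height x` is even, combining the
terms `l = 2i` and `l = 2i + 1` extracts a factor `p + q` and leaves a sum over even `l`.

Whether a permutation is an `F`-permutation, and its number of descents, depend only on its shape.
Valleys and peaks of an `F`-permutation are odd, so each VOP pair contains exactly one element of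
even height, whose left-embracings are the embracing number of the pair. There is one more peak than
there are valleys, the valleys correspond to the descents, and every valley and peak other than
`2n + 1` gives a VOP pair: with `k` descents there are `2k` of them.
-/

namespace OddOdd

open Finset

section Algebra

variable {R : Type*} [CommSemiring R] (p q : R)

theorem sum_range_eq_mul_sum_even {a : ℕ} (ha : Even a) :
    ∑ l ∈ range a, p ^ (a - 1 - l) * q ^ l =
      (p + q) * ∑ l ∈ range a with Even l, p ^ (a - 1 - l - 1) * q ^ l := by
  simp only [sum_filter]
  obtain ⟨b, rfl⟩ := ha
  induction b with
  | zero => simp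
  | succ b ih =>
    have hexp (l : ℕ) : b + b + 1 + 1 - 1 - (l + 1 + 1) = b + b - 1 - l := by omega
    simp only [show b + 1 + (b + 1) = b + b + 1 + 1 by ring, sum_range_succ' _ (b + b + 1),
      sum_range_succ' _ (b + b), hexp, Nat.even_add_one, not_not, pow_succ q, ← mul_assoc,
      ← sum_mul, ih, ← ite_zero_mul]
    simp only [ite_mul, zero_mul, add_tsub_cancel_right, zero_add, pow_zero, mul_one, tsub_zero,
      Even.zero, not_true_eq_false, ↓reduceIte, add_zero]
    ring

theorem sum_piFinset_range_eq_mul_sum_even {ι : Type*} [Fintype ι] [DecidableEq ι] {A : ι → ℕ}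
    {M : Finset ι} (hM : ∀ x ∈ M, Even (A x)) :
    ∑ l ∈ Fintype.piFinset fun x => range (A x), p ^ (∑ x, (A x - 1 - l x)) * q ^ (∑ x, l x) =
      (p + q) ^ #M * ∑ l ∈ Fintype.piFinset fun x => range (A x) with ∀ x ∈ M, Even (l x),
        p ^ (∑ x, (A x - 1 - l x) - #M) * q ^ (∑ x, l x) := by
  have hfilter : {l ∈ Fintype.piFinset fun x => range (A x) | ∀ x ∈ M, Even (l x)} =
      Fintype.piFinset fun x => {l ∈ range (A x) | x ∈ M → Even l} := by
    ext l
    simp only [mem_filter, Fintype.mem_piFinset, forall_and]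
  have hexponent : ∀ l ∈ Fintype.piFinset fun x => {l ∈ range (A x) | x ∈ M → Even l},
      ∑ x, (A x - 1 - l x) - #M = ∑ x, (A x - 1 - l x - if x ∈ M then 1 else 0) := by
    intro l hl
    have hcard : #M = ∑ x, if x ∈ M then 1 else 0 := by simp
    rw [hcard, ← sum_tsub_distrib]
    intro x _
    have hlx := Fintype.mem_piFinset.1 hl x
    have := hM x
    grind
  have hfactor (x : ι) : ∑ l ∈ range (A x), p ^ (A x - 1 - l) * q ^ l =
      (if x ∈ M then p + q else 1) * ∑ l ∈ range (A x) with x ∈ M → Even l,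
        p ^ (A x - 1 - l - if x ∈ M then 1 else 0) * q ^ l := by
    by_cases hx : x ∈ M
    · simpa [hx] using sum_range_eq_mul_sum_even p q (hM x hx)
    · simp [hx]
  have hpow : (p + q) ^ #M = ∏ x, if x ∈ M then p + q else 1 := by simp
  rw [hfilter, sum_congr rfl fun l hl => congrArg (p ^ · * _) (hexponent l hl), hpow]
  simp only [← prod_pow_eq_pow_sum, ← prod_mul_distrib]
  rw [← prod_univ_sum _ fun x l => p ^ (A x - 1 - l) * q ^ l,
    ← prod_univ_sum _ fun x l => p ^ (A x - 1 - l - if x ∈ M then 1 else 0) * q ^ l,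
    ← prod_mul_distrib]
  exact prod_congr rfl fun x _ => hfactor x

end Algebra

theorem card_le_sum_sub_of_even {ι : Type*} {A l : ι → ℕ} {s M : Finset ι} (hM : M ⊆ s)
    (hA : ∀ x ∈ M, Even (A x)) (hl : ∀ x ∈ M, Even (l x)) (hlt : ∀ x ∈ M, l x < A x) :
    #M ≤ ∑ x ∈ s, (A x - 1 - l x) := by
  calc #M = ∑ x ∈ M, 1 := card_eq_sum_ones M
    _ ≤ ∑ x ∈ M, (A x - 1 - l x) := sum_le_sum fun x hx => by
      have := hlt x hx
      have := hA x hx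
      have := hl x hx
      grind
    _ ≤ ∑ x ∈ s, (A x - 1 - l x) := sum_le_sum_of_subset hM

theorem even_toNat {z : ℤ} (hz : Even z) : Even z.toNat := by
  obtain ⟨k, rfl⟩ := hz
  exact ⟨k.toNat, by omega⟩

section Scan

variable {α : Type*} [LinearOrder α]

/-- One step of the left-to-right scan that computes `profile`. -/
def profileStep (x : α) (s : Bool × ℕ) (c : α) : Bool × ℕ :=
  (decide (x < c), s.2 + if s.1 ∧ c < x then 1 else 0)

/-- What the letter `x` sees on its left in a word starting with `A x`: whether the letter before
it is larger, and the number of descents `a > b` of `A` with `a > x > b`. -/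
def profile (x : α) (A : List α) : Bool × ℕ := A.foldl (profileStep x) (false, 0)

/-- The profile of the part of the word `w` that precedes the first occurrence of `x`. -/
def leftProfile (w : List α) (x : α) : Bool × ℕ := profile x (w.takeWhile (· ≠ x))

/-- The left profiles of `x` in the word `w` and in its reversal, regrouped: first whether the left
and the right neighbour of `x` are larger, then how many descents on the left and how many ascents
on the right pass over `x`. -/
def sides (w : List α) (x : α) : (Bool × Bool) × (ℕ × ℕ) :=
  (((leftProfile w x).1, (leftProfile w.reverse x).1),
    ((leftProfile w x).2, (leftProfile w.reverse x).2))

theorem profile_concat (x c : α) (A : List α) :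
    profile x (A ++ [c]) = profileStep x (profile x A) c := by
  simp [profile]

theorem foldl_profileStep_of_lt {x : α} {C : List α} (hC : C ≠ []) (h : ∀ c ∈ C, x < c)
    (s : Bool × ℕ) : C.foldl (profileStep x) s = (true, s.2) := by
  induction C generalizing s with
  | nil => contradiction
  | cons c C ih =>
    have hc : x < c := h c (by simp)
    have hstep : profileStep x s c = (true, s.2) := by simp [profileStep, hc, hc.not_gt]
    rcases eq_or_ne C [] with rfl | hC'
    · simpa using hstep
    · simpa [hstep] using ih hC' (fun c hc => h c (List.mem_cons_of_mem _ hc)) (true, s.2)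

theorem leftProfile_append_cons {x : α} {A : List α} (hx : x ∉ A) (B : List α) :
    leftProfile (A ++ x :: B) x = profile x A := by
  have hA : ∀ a ∈ A, decide (a ≠ x) = true := fun a ha =>
    decide_eq_true (ne_of_mem_of_not_mem ha hx)
  rw [leftProfile, List.takeWhile_append_of_pos hA, List.takeWhile_cons_of_neg (by simp),
    List.append_nil]

theorem leftProfile_append_of_lt {x : α} {C C' : List α} (hC : C ≠ []) (hC' : C' ≠ [])
    (h : ∀ c ∈ C, x < c) (h' : ∀ c ∈ C', x < c) (A B : List α) :
    leftProfile (A ++ C ++ B) x = leftProfile (A ++ C' ++ B) x := by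
  by_cases hA : x ∈ A
  · obtain ⟨A₁, A₂, rfl, hxA⟩ := List.eq_append_cons_of_mem hA
    simp only [List.append_assoc, List.cons_append, leftProfile_append_cons hxA]
  · have hfold : ∀ D : List α, D ≠ [] → (∀ c ∈ D, x < c) → leftProfile (A ++ D ++ B) x =
        (B.takeWhile (· ≠ x)).foldl (profileStep x) (true, (profile x A).2) := by
      intro D hD hlt
      have hpos : ∀ a ∈ A ++ D, decide (a ≠ x) = true := by
        intro a ha
        rcases List.mem_append.1 ha with ha | ha
        · exact decide_eq_true (ne_of_mem_of_not_mem ha hA)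
        · exact decide_eq_true (hlt a ha).ne'
      rw [leftProfile, List.takeWhile_append_of_pos hpos, profile, List.foldl_append,
        List.foldl_append, foldl_profileStep_of_lt hD hlt, profile]
    rw [hfold C hC h, hfold C' hC' h']

theorem sides_append_of_lt {x : α} {C C' : List α} (hC : C ≠ []) (hC' : C' ≠ [])
    (h : ∀ c ∈ C, x < c) (h' : ∀ c ∈ C', x < c) (A B : List α) :
    sides (A ++ C ++ B) x = sides (A ++ C' ++ B) x := by
  have hrev := leftProfile_append_of_lt (x := x) (C := C.reverse) (C' := C'.reverse)
    (by simpa using hC) (by simpa using hC') (by simpa using h) (by simpa using h')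
    B.reverse A.reverse
  simp only [sides, leftProfile_append_of_lt hC hC' h h', List.reverse_append,
    ← List.append_assoc, hrev]

end Scan

theorem append_cons_inj_of_count_eq {α : Type*} [BEq α] [LawfulBEq α] {a : α} {A B A' B' : List α}
    (h : A ++ a :: B = A' ++ a :: B') (hcount : A.count a = A'.count a) : A = A' ∧ B = B' := by
  have idx : ∀ C D : List α, (C ++ a :: D).idxOfNth a (C.count a) = C.length := by
    intro C D
    have hbefore : (C ++ a :: D).countBefore a C.length = C.count a := by
      simp [List.countBefore_eq_count_take]
    rw [← hbefore]
    exact List.idxOfNth_countBefore_of_lt_length_of_beq (h := by simp) (by simp)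
  have hlength : A.length = A'.length := by rw [← idx A B, ← idx A' B', h, hcount]
  simpa using List.append_inj h hlength

theorem exists_split_of_lt_count {α : Type*} [BEq α] [LawfulBEq α] {a : α} {l : ℕ} {w : List α}
    (h : l < w.count a) : ∃ A B, w = A ++ a :: B ∧ A.count a = l := by
  have hlt : w.idxOfNth a l < w.length := List.idxOfNth_lt_length_of_lt_count h
  refine ⟨w.take (w.idxOfNth a l), w.drop (w.idxOfNth a l + 1), ?_, ?_⟩
  · conv_lhs => rw [← List.take_append_drop (w.idxOfNth a l) w, List.drop_eq_getElem_cons hlt,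
      List.getElem_idxOfNth_eq]
  · rw [← List.countBefore_eq_count_take, List.countBefore_idxOfNth_of_lt_count h]

/-- An open word on `{1, …, r}`: what remains of the word of a permutation when each maximal run
of letters larger than `r` is collapsed to a single gap `⊤`. -/
structure IsOpenWord (r : ℕ) (w : List ℕ∞) : Prop where
  ne_nil : w ≠ []
  count_eq : ∀ y : ℕ, w.count (y : ℕ∞) = if y ∈ Icc 1 r then 1 else 0
  isolated : w.IsChain fun a b => a ≠ ⊤ ∨ b ≠ ⊤

/-- The letter `x`, flanked by a gap on the left and on the right as prescribed by `s`. -/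
def block (x : ℕ) (s : Bool × Bool) : List ℕ∞ :=
  (if s.1 then [⊤] else []) ++ (x : ℕ∞) :: if s.2 then [⊤] else []

theorem reverse_block (x : ℕ) (s : Bool × Bool) : (block x s).reverse = block x s.swap := by
  rcases s with ⟨_ | _, _ | _⟩ <;> rfl

theorem lt_of_mem_block {x j : ℕ} (hx : x < j) (s : Bool × Bool) :
    ∀ c ∈ block j s, (x : ℕ∞) < c := by
  rcases s with ⟨_ | _, _ | _⟩ <;> simp [block, hx]

theorem count_insert (y j : ℕ) (s : Bool × Bool) (A B : List ℕ∞) :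
    (A ++ block j s ++ B).count (y : ℕ∞) =
      (A ++ ⊤ :: B).count (y : ℕ∞) + if y = j then 1 else 0 := by
  have hblock : (block j s).count (y : ℕ∞) = if y = j then 1 else 0 := by
    rcases s with ⟨_ | _, _ | _⟩ <;> simp [block, List.count_cons, @eq_comm ℕ y]
  simp only [List.count_append, hblock, List.count_cons_of_ne (ENat.top_ne_natCast y)]
  omega

theorem count_top_insert (j : ℕ) (s : Bool × Bool) (A B : List ℕ∞) :
    (A ++ block j s ++ B).count ⊤ + 1 =
      (A ++ ⊤ :: B).count ⊤ + s.1.toNat + s.2.toNat := by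
  rcases s with ⟨_ | _, _ | _⟩ <;> simp [block] <;> omega

theorem sides_insert {x j : ℕ} (hx : x < j) (s : Bool × Bool) (A B : List ℕ∞) :
    sides (A ++ block j s ++ B) x = sides (A ++ ⊤ :: B) x := by
  rw [sides_append_of_lt (C' := [⊤]) (by simp [block]) (by simp) (lt_of_mem_block hx s) (by simp),
    List.append_assoc, List.singleton_append]

/-- The number of gaps of the open word on `{1, …, x - 1}` obtained from `w`, computed from the
flags of `sides`: inserting `y` uses up one gap and creates one for each larger neighbour of `y`. -/
def gapsBelow (w : List ℕ∞) (x : ℕ) : ℤ :=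
  1 + ∑ y ∈ Ico 1 x, (((sides w y).1.1.toNat : ℤ) + (sides w y).1.2.toNat - 1)

theorem gapsBelow_succ {x : ℕ} (hx : 1 ≤ x) (w : List ℕ∞) :
    gapsBelow w (x + 1) =
      gapsBelow w x + ((sides w x).1.1.toNat + (sides w x).1.2.toNat - 1) := by
  rw [gapsBelow, gapsBelow, sum_Ico_succ_top hx, add_assoc]

theorem gapsBelow_congr {x : ℕ} {w w' : List ℕ∞}
    (h : ∀ y ∈ Ico 1 x, (sides w y).1 = (sides w' y).1) : gapsBelow w x = gapsBelow w' x := by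
  rw [gapsBelow, gapsBelow, sum_congr rfl fun y hy => by rw [h y hy]]

theorem gapsBelow_insert {x j : ℕ} (hx : x ≤ j) (s : Bool × Bool) (A B : List ℕ∞) :
    gapsBelow (A ++ block j s ++ B) x = gapsBelow (A ++ ⊤ :: B) x :=
  gapsBelow_congr fun y hy => by rw [sides_insert ((mem_Ico.1 hy).2.trans_le hx)]

theorem profile_of_isolated {x : ℕ} {A : List ℕ∞} (hA : ∀ a ∈ A, a = ⊤ ∨ a < x)
    (hiso : A.IsChain fun a b => a ≠ ⊤ ∨ b ≠ ⊤) :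
    (profile (x : ℕ∞) A).1 = decide (⊤ ∈ A.getLast?) ∧
      (profile (x : ℕ∞) A).2 + (profile (x : ℕ∞) A).1.toNat = A.count ⊤ := by
  induction A using List.reverseRecOn with
  | nil => simp [profile]
  | append_singleton A c ih =>
    obtain ⟨hiso, -, hc⟩ := List.isChain_append.1 hiso
    obtain ⟨hlast, hcount⟩ := ih (fun a ha => hA a (by simp [ha])) hiso
    rcases hA c (by simp) with rfl | hcx
    · have hfalse : (profile (x : ℕ∞) A).1 = false := by
        rw [hlast, decide_eq_false_iff_not]
        exact fun h => by simpa using hc _ h _ rfl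
      simp_all [profile_concat, profileStep]
    · have hlt : (profile (x : ℕ∞) A).1.toNat = if (profile (x : ℕ∞) A).1 then 1 else 0 := by
        cases (profile (x : ℕ∞) A).1 <;> rfl
      simp [profile_concat, profileStep, hcx, hcx.not_gt, hcx.ne_top, ← hcount, hlt]

theorem leftProfile_insert_self {x : ℕ} {A : List ℕ∞} (hA : ∀ a ∈ A, a = ⊤ ∨ a < x)
    (hiso : (A ++ [⊤]).IsChain fun a b => a ≠ ⊤ ∨ b ≠ ⊤) (s : Bool × Bool) (B : List ℕ∞) :
    leftProfile (A ++ block x s ++ B) x = (s.1, A.count ⊤) := by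
  have hx : (x : ℕ∞) ∉ A ++ if s.1 then [⊤] else [] := by
    have hxA : (x : ℕ∞) ∉ A := fun h => by simpa using hA _ h
    cases s.1 <;> simpa using hxA
  obtain ⟨hisoA, -, hlast⟩ := List.isChain_append.1 hiso
  obtain ⟨hfst, hsnd⟩ := profile_of_isolated hA hisoA
  have hfalse : (profile (x : ℕ∞) A).1 = false := by
    rw [hfst, decide_eq_false_iff_not]
    exact fun h => by simpa using hlast _ h _ rfl
  have hprofile : profile (x : ℕ∞) A = (false, A.count ⊤) := by
    ext1 <;> simp_all
  rw [block, ← List.append_assoc, List.append_assoc, List.cons_append, leftProfile_append_cons hx]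
  cases s.1 <;> simp [profile_concat, profileStep, hprofile]

theorem exists_concat_of_isolated {α : Type*} {t : α} {P : List α}
    (hP : P.IsChain fun a b => a ≠ t ∨ b ≠ t) :
    ∃ (A : List α) (b : Bool), P = A ++ (if b then [t] else []) ∧
      (A ++ [t]).IsChain fun a b => a ≠ t ∨ b ≠ t := by
  rcases P.eq_nil_or_concat with rfl | ⟨A, c, rfl⟩
  · exact ⟨[], false, by simp⟩
  · by_cases hc : c = t
    · exact ⟨A, true, by simp [hc], by simpa [hc] using hP⟩
    · exact ⟨A ++ [c], false, by simp, by simp_all [List.isChain_append]⟩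

namespace IsOpenWord

variable {r : ℕ} {w w' A B : List ℕ∞}

theorem reverse (h : IsOpenWord r w) : IsOpenWord r w.reverse where
  ne_nil := by simpa using h.ne_nil
  count_eq y := by rw [List.count_reverse, h.count_eq]
  isolated := List.isChain_reverse.2 (h.isolated.imp fun _ _ => Or.symm)

theorem mem_iff (h : IsOpenWord r w) {y : ℕ} : (y : ℕ∞) ∈ w ↔ y ∈ Icc 1 r := by
  rw [← List.count_pos_iff, h.count_eq]
  split_ifs <;> simp_all

theorem eq_top_or_lt (h : IsOpenWord r w) : ∀ a ∈ w, a = ⊤ ∨ a < (r + 1 : ℕ) := by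
  intro a ha
  induction a using ENat.recTopCoe with
  | top => exact Or.inl rfl
  | coe y => exact Or.inr (Nat.cast_lt.2 (Nat.lt_succ_of_le (mem_Icc.1 (h.mem_iff.1 ha)).2))

theorem eq_singleton_top (h : IsOpenWord 0 w) : w = [⊤] := by
  have htop : ∀ a ∈ w, a = ⊤ := fun a ha => by
    induction a using ENat.recTopCoe with
    | top => rfl
    | coe y => simpa using h.mem_iff.1 ha
  have hiso := h.isolated
  match w, h.ne_nil, htop, hiso with
  | [a], _, htop, _ => simpa using htop
  | a :: b :: t, _, htop, hiso => simp_all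

theorem sides_insert_self (h : IsOpenWord r (A ++ ⊤ :: B)) (s : Bool × Bool) :
    sides (A ++ block (r + 1) s ++ B) (r + 1 : ℕ) = (s, (A.count ⊤, B.count ⊤)) := by
  have hiso := List.isChain_split.1 h.isolated
  have hiso' := List.isChain_split.1 (by simpa using h.reverse.isolated :
    (B.reverse ++ ⊤ :: A.reverse).IsChain fun a b => a ≠ ⊤ ∨ b ≠ ⊤)
  have hmem := h.eq_top_or_lt
  have hleft := leftProfile_insert_self (fun a ha => hmem a (by simp [ha])) hiso.1 s B
  have hright := leftProfile_insert_self (fun a ha => hmem a (by simp_all)) hiso'.1 s.swap A.reverse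
  rw [sides, List.reverse_append, List.reverse_append, reverse_block, ← List.append_assoc, hleft,
    hright, List.count_reverse, Prod.fst_swap]

theorem insert (h : IsOpenWord r (A ++ ⊤ :: B)) (s : Bool × Bool) :
    IsOpenWord (r + 1) (A ++ block (r + 1) s ++ B) where
  ne_nil := by simp [block]
  count_eq y := by
    rw [count_insert, h.count_eq]
    simp only [mem_Icc]
    split_ifs <;> omega
  isolated := by
    obtain ⟨hA, hB⟩ := List.isChain_split.1 h.isolated
    rcases s with ⟨_ | _, _ | _⟩ <;> simp_all [block, List.isChain_append, List.isChain_cons]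

theorem exists_split (h : IsOpenWord (r + 1) w) :
    ∃ A B s, w = A ++ block (r + 1) s ++ B ∧ IsOpenWord r (A ++ ⊤ :: B) := by
  obtain ⟨P, Q, rfl⟩ := List.append_of_mem (h.mem_iff.2 (right_mem_Icc.2 (Nat.le_add_left 1 r)))
  obtain ⟨hP, hQ⟩ := List.isChain_split.1 h.isolated
  obtain ⟨A, b, rfl, hA⟩ := exists_concat_of_isolated hP.left_of_append
  obtain ⟨B, c, hQB, hB⟩ := exists_concat_of_isolated (P := Q.reverse)
    (List.isChain_reverse.2 (hQ.tail.imp fun _ _ => Or.symm))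
  obtain rfl : Q = (if c then [⊤] else []) ++ B.reverse := by
    rw [← Q.reverse_reverse, hQB]
    cases c <;> simp
  have hw : A ++ (if b then [⊤] else []) ++ ((r + 1 : ℕ) : ℕ∞) ::
      ((if c then [⊤] else []) ++ B.reverse) = A ++ block (r + 1) (b, c) ++ B.reverse := by
    simp [block]
  refine ⟨A, B.reverse, (b, c), hw, by simp, fun y => ?_, List.isChain_split.2 ⟨hA, ?_⟩⟩
  · have hy := h.count_eq y
    rw [hw, count_insert] at hy
    simp only [mem_Icc] at hy ⊢
    split_ifs at hy ⊢ <;> omega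
  · simpa using List.isChain_reverse.2 (hB.imp fun _ _ => Or.symm)

theorem ext (h : IsOpenWord r w) (h' : IsOpenWord r w')
    (hflags : ∀ x ∈ Icc 1 r, (sides w x).1 = (sides w' x).1)
    (hleft : ∀ x ∈ Icc 1 r, (sides w x).2.1 = (sides w' x).2.1) : w = w' := by
  induction r generalizing w w' with
  | zero => rw [h.eq_singleton_top, h'.eq_singleton_top]
  | succ r ih =>
    obtain ⟨A, B, s, rfl, hAB⟩ := h.exists_split
    obtain ⟨A', B', s', rfl, hAB'⟩ := h'.exists_split
    have hr : r + 1 ∈ Icc 1 (r + 1) := by simp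
    obtain rfl : s = s' := by
      simpa only [hAB.sides_insert_self, hAB'.sides_insert_self] using hflags _ hr
    have hcount : A.count ⊤ = A'.count ⊤ := by
      simpa only [hAB.sides_insert_self, hAB'.sides_insert_self] using hleft _ hr
    have heq : A ++ ⊤ :: B = A' ++ ⊤ :: B' := by
      refine ih hAB hAB' (fun x hx => ?_) (fun x hx => ?_)
      · simpa only [sides_insert (Nat.lt_succ_of_le (mem_Icc.1 hx).2)] using
          hflags x (Icc_subset_Icc_right r.le_succ hx)
      · simpa only [sides_insert (Nat.lt_succ_of_le (mem_Icc.1 hx).2)] using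
          hleft x (Icc_subset_Icc_right r.le_succ hx)
    obtain ⟨rfl, rfl⟩ := append_cons_inj_of_count_eq heq hcount
    rfl

theorem count_top (h : IsOpenWord r w) : (w.count ⊤ : ℤ) = gapsBelow w (r + 1) := by
  induction r generalizing w with
  | zero => simp [h.eq_singleton_top, gapsBelow]
  | succ r ih =>
    obtain ⟨A, B, s, rfl, hAB⟩ := h.exists_split
    have hcount := count_top_insert (r + 1) s A B
    rw [gapsBelow_succ (Nat.le_add_left 1 r), gapsBelow_insert le_rfl, ← ih hAB,
      hAB.sides_insert_self]
    grind

theorem embracings_add_one (h : IsOpenWord r w) {x : ℕ} (hx : x ∈ Icc 1 r) :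
    ((sides w x).2.1 + (sides w x).2.2 + 1 : ℤ) = gapsBelow w x := by
  induction r generalizing w with
  | zero => simp at hx
  | succ r ih =>
    obtain ⟨A, B, s, rfl, hAB⟩ := h.exists_split
    obtain ⟨hx₁, hxr⟩ := mem_Icc.1 hx
    rw [gapsBelow_insert hxr]
    obtain hlt | rfl := hxr.lt_or_eq
    · rw [sides_insert hlt]
      exact ih hAB (mem_Icc.2 ⟨hx₁, Nat.lt_succ_iff.1 hlt⟩)
    · rw [hAB.sides_insert_self, ← hAB.count_top]
      simp [List.count_append, add_assoc]

theorem exists_sides_eq (h : IsOpenWord r w) {l : ℕ → ℕ}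
    (hl : ∀ x ∈ Icc 1 r, (l x : ℤ) < gapsBelow w x) :
    ∃ v, IsOpenWord r v ∧
      ∀ x ∈ Icc 1 r, (sides v x).1 = (sides w x).1 ∧ (sides v x).2.1 = l x := by
  induction r generalizing w with
  | zero => exact ⟨w, h, by simp⟩
  | succ r ih =>
    obtain ⟨A, B, s, rfl, hAB⟩ := h.exists_split
    obtain ⟨v, hv, hsides⟩ := ih hAB fun x hx => by
      simpa only [gapsBelow_insert (Nat.le_succ_of_le (mem_Icc.1 hx).2)] using
        hl x (Icc_subset_Icc_right r.le_succ hx)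
    have hgaps : (v.count ⊤ : ℤ) = gapsBelow (A ++ block (r + 1) s ++ B) (r + 1) := by
      rw [gapsBelow_insert le_rfl, hv.count_top]
      exact gapsBelow_congr fun x hx => (hsides x (by simpa using hx)).1
    have hlt : l (r + 1) < v.count ⊤ := by
      have := hl (r + 1) (by simp)
      omega
    obtain ⟨C, D, rfl, hC⟩ := exists_split_of_lt_count hlt
    refine ⟨C ++ block (r + 1) s ++ D, hv.insert s, fun x hx => ?_⟩
    obtain ⟨hx₁, hxr⟩ := mem_Icc.1 hx
    obtain hlt | rfl := hxr.lt_or_eq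
    · simpa only [sides_insert hlt] using hsides x (mem_Icc.2 ⟨hx₁, Nat.lt_succ_iff.1 hlt⟩)
    · rw [hv.sides_insert_self, hAB.sides_insert_self, hC]
      exact ⟨rfl, rfl⟩

end IsOpenWord

section Permutation

variable {m : ℕ} (σ : Equiv.Perm (Fin m))

theorem entry_zero : entry σ 0 = 0 := by simp [entry]

theorem entry_of_lt {i : ℕ} (hi : m < i) : entry σ i = 0 := by simp [entry, hi.not_ge]

theorem entry_succ {i : ℕ} (hi : i < m) : entry σ (i + 1) = σ ⟨i, hi⟩ + 1 := by
  simp [entry, Nat.succ_le_of_lt hi]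

theorem entry_mem_Icc {j : ℕ} (hj : j ∈ Icc 1 m) : entry σ j ∈ Icc 1 m := by
  obtain ⟨h1, hm⟩ := mem_Icc.1 hj
  simp [entry, h1, hm]

theorem eq_of_entry_eq {i j : ℕ} (hj : j ∈ Icc 1 m) (h : entry σ i = entry σ j) : i = j := by
  have hpos : 1 ≤ entry σ j := (mem_Icc.1 (entry_mem_Icc σ hj)).1
  have hi : 1 ≤ i ∧ i ≤ m := by
    by_contra hi
    rw [entry, dif_neg hi] at h
    omega
  rw [mem_Icc] at hj
  simp only [entry, hi, hj, and_self, dite_true, Nat.add_right_cancel_iff, Fin.val_inj,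
    σ.injective.eq_iff, Fin.mk.injEq] at h
  omega

theorem exists_entry_eq {x : ℕ} (hx : x ∈ Icc 1 m) : ∃ j ∈ Icc 1 m, entry σ j = x := by
  obtain ⟨h1, hm⟩ := mem_Icc.1 hx
  refine ⟨σ.symm ⟨x - 1, by omega⟩ + 1, by simp, ?_⟩
  rw [entry_succ σ (Fin.is_lt _)]
  simp [h1]

theorem entry_mem_image_filter_iff {j : ℕ} (hj : j ∈ Icc 1 m) (P : ℕ → Prop) [DecidablePred P] :
    entry σ j ∈ ((Icc 1 m).filter P).image (entry σ) ↔ P j := by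
  simp only [mem_image, mem_filter]
  exact ⟨fun ⟨i, hi, h⟩ => eq_of_entry_eq σ hj h ▸ hi.2, fun h => ⟨j, ⟨hj, h⟩, rfl⟩⟩

/-- The word `σ₁ ⋯ σ_m`, as a word in which gaps `⊤` could occur. -/
def word : List ℕ∞ := List.ofFn fun i => ((σ i + 1 : ℕ) : ℕ∞)

theorem length_word : (word σ).length = m := by simp [word]

theorem getElem_word {i : ℕ} (hi : i < (word σ).length) : (word σ)[i] = entry σ (i + 1) := by
  simp [word, entry_succ σ ((length_word σ).symm ▸ hi : i < m)]

theorem word_injective : Function.Injective (word (m := m)) := fun σ τ h => by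
  ext i
  simpa using congrFun (List.ofFn_injective h) i

theorem nodup_word : (word σ).Nodup := by
  rw [word, List.nodup_ofFn]
  exact fun i j h => by simpa [Fin.val_inj] using h

theorem mem_word {y : ℕ} : (y : ℕ∞) ∈ word σ ↔ y ∈ Icc 1 m := by
  rw [word, List.mem_ofFn]
  constructor
  · rintro ⟨i, hi⟩
    rw [← Nat.cast_inj.1 hi, mem_Icc]
    omega
  · intro hy
    obtain ⟨j, hj, rfl⟩ := exists_entry_eq σ hy
    obtain ⟨i, rfl⟩ := Nat.exists_eq_add_of_le' (mem_Icc.1 hj).1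
    exact ⟨⟨i, (mem_Icc.1 hj).2⟩, by rw [entry_succ σ (mem_Icc.1 hj).2]⟩

theorem top_notMem_word : ⊤ ∉ word σ := by
  simp [word, List.mem_ofFn]

theorem isOpenWord_word [NeZero m] : IsOpenWord m (word σ) where
  ne_nil := List.ne_nil_of_length_pos (by simp [length_word, NeZero.pos])
  count_eq y := by simp [List.Nodup.count (nodup_word σ), mem_word]
  isolated := (List.pairwise_of_forall_mem_list fun a ha b _ =>
    Or.inl (ne_of_mem_of_not_mem ha (top_notMem_word σ))).isChain

theorem exists_word_eq [NeZero m] {w : List ℕ∞} (hw : IsOpenWord m w) (htop : w.count ⊤ = 0) :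
    ∃ σ : Equiv.Perm (Fin m), word σ = w := by
  have hperm : w.Perm (word (1 : Equiv.Perm (Fin m))) := List.perm_iff_count.2 fun a => by
    induction a using ENat.recTopCoe with
    | top => rw [htop, List.count_eq_zero_of_not_mem (top_notMem_word 1)]
    | coe y => rw [hw.count_eq, (isOpenWord_word 1).count_eq]
  have hlength : w.length = m := by rw [hperm.length_eq, length_word]
  have hnodup : w.Nodup := hperm.nodup_iff.2 (nodup_word 1)
  have hletter : ∀ i : Fin m, ∃ k : Fin m, w[i] = ((k + 1 : ℕ) : ℕ∞) := fun i => by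
    have hi : w[i] ∈ word (1 : Equiv.Perm (Fin m)) := hperm.subset (List.getElem_mem _)
    obtain ⟨k, hk⟩ := List.mem_ofFn.1 hi
    exact ⟨k, hk.symm⟩
  choose f hf using hletter
  have hinj : Function.Injective f := fun i j hij => by
    have hij : w[i] = w[j] := by rw [hf, hf, hij]
    exact Fin.ext ((hnodup.getElem_inj_iff).1 hij)
  refine ⟨Equiv.ofBijective f (Finite.injective_iff_bijective.1 hinj),
    List.ext_getElem (by rw [length_word, hlength]) fun i hi hi' => ?_⟩
  simpa [word] using (hf ⟨i, hlength ▸ hi'⟩).symm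

theorem profile_take_word (x : ℕ) {j : ℕ} (hj : j ≤ m) :
    profile (x : ℕ∞) ((word σ).take j) = (decide (x < entry σ j),
      #{i ∈ range j | x < entry σ i ∧ entry σ (i + 1) < x}) := by
  induction j with
  | zero => simp [profile, entry_zero]
  | succ j ih =>
    have hlt : j < (word σ).length := by rwa [length_word]
    rw [← List.take_concat_get' _ _ hlt, profile_concat, ih (Nat.le_of_succ_le hj), getElem_word,
      range_add_one, filter_insert]
    split_ifs with h <;> simp [profileStep, h]

theorem leftEmbracings_entry {j : ℕ} (hj : j ∈ Icc 1 m) : leftEmbracings σ (entry σ j) =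
    #{i ∈ range (j - 1) | entry σ j < entry σ i ∧ entry σ (i + 1) < entry σ j} := by
  have hsnd : ∀ i, entry σ i = entry σ j → i = j := fun i => eq_of_entry_eq σ hj
  have hzero := entry_zero σ
  refine card_nbij' (fun z => z.1 - 1) (fun i => (i + 1, j)) ?_ ?_ ?_ ?_
  all_goals
    simp only [Set.MapsTo, Set.LeftInvOn, coe_filter, lesPairs, mem_filter, mem_product, mem_Icc,
      mem_range, Set.mem_ofPred_eq, Prod.forall] at hj ⊢
    grind

theorem leftProfile_word_entry {j : ℕ} (hj : j ∈ Icc 1 m) :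
    leftProfile (word σ) (entry σ j) =
      (decide (entry σ j < entry σ (j - 1)), leftEmbracings σ (entry σ j)) := by
  obtain ⟨i, rfl⟩ := Nat.exists_eq_add_of_le' (mem_Icc.1 hj).1
  have hi : i < m := (mem_Icc.1 hj).2
  have hlt : i < (word σ).length := by rwa [length_word]
  have hsplit : word σ = (word σ).take i ++ (entry σ (i + 1) : ℕ∞) :: (word σ).drop (i + 1) := by
    rw [← getElem_word σ hlt, ← List.drop_eq_getElem_cons, List.take_append_drop]
  have hnot : (entry σ (i + 1) : ℕ∞) ∉ (word σ).take i := by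
    have hnodup := nodup_word σ
    rw [hsplit] at hnodup
    exact fun h => (List.disjoint_of_nodup_append hnodup) h (by simp)
  rw [leftEmbracings_entry σ hj, Nat.add_sub_cancel, ← profile_take_word σ _ hi.le]
  conv_lhs => rw [hsplit]
  exact leftProfile_append_cons hnot _

/-- The reversed permutation `σ_m ⋯ σ₁`. -/
def mirror : Equiv.Perm (Fin m) := Fin.revPerm.trans σ

theorem word_mirror : word (mirror σ) = (word σ).reverse := by
  refine List.ext_getElem (by simp [word]) fun i hi hi' => ?_
  simp [word, mirror, Fin.rev, Nat.sub_sub, add_comm]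

theorem entry_mirror {i : ℕ} (hi : i ≤ m + 1) : entry (mirror σ) i = entry σ (m + 1 - i) := by
  rcases i with _ | i
  · rw [entry_zero, entry_of_lt σ (by omega)]
  · obtain hlt | rfl := (Nat.le_of_succ_le_succ hi).lt_or_eq
    · rw [entry_succ _ hlt, show m + 1 - (i + 1) = m - (i + 1) + 1 by omega,
        entry_succ σ (by omega)]
      rfl
    · rw [entry_of_lt _ i.lt_succ_self, Nat.sub_self, entry_zero]

theorem res_eq_les_mirror : res σ = les (mirror σ) := by
  have hmirror : ∀ i ≤ m + 1, entry (mirror σ) i = entry σ (m + 1 - i) := fun i =>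
    entry_mirror σ
  refine card_nbij' (fun z => (m + 1 - z.2, m + 1 - z.1)) (fun z => (m + 1 - z.2, m + 1 - z.1))
    ?_ ?_ ?_ ?_
  all_goals
    simp only [Set.MapsTo, Set.LeftInvOn, coe_filter, lesPairs, mem_product, mem_Icc, mem_Ico,
      Set.mem_ofPred_eq, Prod.forall]
    grind

theorem sides_word_entry {j : ℕ} (hj : j ∈ Icc 1 m) :
    sides (word σ) (entry σ j) =
      ((decide (entry σ j < entry σ (j - 1)), decide (entry σ j < entry σ (j + 1))),
        (leftEmbracings σ (entry σ j), leftEmbracings (mirror σ) (entry σ j))) := by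
  obtain ⟨h1, hm⟩ := mem_Icc.1 hj
  have hj' : m + 1 - j ∈ Icc 1 m := by rw [mem_Icc]; omega
  have hentry : entry (mirror σ) (m + 1 - j) = entry σ j := by
    rw [entry_mirror σ (by omega), Nat.sub_sub_self (by omega)]
  have hnext : entry (mirror σ) (m + 1 - j - 1) = entry σ (j + 1) := by
    rw [entry_mirror σ (by omega), show m + 1 - (m + 1 - j - 1) = j + 1 by omega]
  have hright := leftProfile_word_entry (mirror σ) hj'
  rw [hentry, hnext, word_mirror] at hright
  rw [sides, leftProfile_word_entry σ hj, hright]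

variable {σ} {x : ℕ}

theorem sides_word_snd (hx : x ∈ Icc 1 m) :
    (sides (word σ) x).2 = (leftEmbracings σ x, leftEmbracings (mirror σ) x) := by
  obtain ⟨j, hj, rfl⟩ := exists_entry_eq σ hx
  rw [sides_word_entry σ hj]

theorem mem_valleys_iff (hx : x ∈ Icc 1 m) :
    x ∈ valleys σ ↔ (sides (word σ) x).1 = (true, true) := by
  obtain ⟨j, hj, rfl⟩ := exists_entry_eq σ hx
  simp [valleys, entry_mem_image_filter_iff σ hj, sides_word_entry σ hj]

theorem entry_ne_entry {i j : ℕ} (hj : j ∈ Icc 1 m) (hij : i ≠ j) : entry σ i ≠ entry σ j :=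
  fun h => hij (eq_of_entry_eq σ hj h)

theorem mem_peaks_iff (hx : x ∈ Icc 1 m) :
    x ∈ peaks σ ↔ (sides (word σ) x).1 = (false, false) := by
  obtain ⟨j, hj, rfl⟩ := exists_entry_eq σ hx
  have hprev : entry σ (j - 1) ≠ entry σ j := entry_ne_entry hj (by grind)
  have hnext : entry σ (j + 1) ≠ entry σ j := entry_ne_entry hj (by simp)
  simp [peaks, entry_mem_image_filter_iff σ hj, sides_word_entry σ hj, hprev.le_iff_lt,
    hnext.le_iff_lt]

theorem mem_doubleDescents_iff (hx : x ∈ Icc 1 m) :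
    x ∈ doubleDescents σ ↔ (sides (word σ) x).1 = (true, false) := by
  obtain ⟨j, hj, rfl⟩ := exists_entry_eq σ hx
  have hnext : entry σ (j + 1) ≠ entry σ j := entry_ne_entry hj (by simp)
  simp [doubleDescents, entry_mem_image_filter_iff σ hj, sides_word_entry σ hj, hnext.le_iff_lt]

theorem les_eq_sum_leftEmbracings (σ : Equiv.Perm (Fin m)) :
    les σ = ∑ x ∈ Icc 1 m, leftEmbracings σ x :=
  card_eq_sum_card_fiberwise fun z hz => by
    simp only [lesPairs, coe_filter, mem_product, mem_Icc, Set.mem_ofPred_eq] at hz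
    exact entry_mem_Icc σ (mem_Icc.2 ⟨by omega, hz.1.2.2⟩)

theorem valleys_subset (σ : Equiv.Perm (Fin m)) : valleys σ ⊆ Icc 1 m :=
  image_subset_iff.2 fun _ hj => entry_mem_Icc σ (filter_subset _ _ hj)

theorem peaks_subset (σ : Equiv.Perm (Fin m)) : peaks σ ⊆ Icc 1 m :=
  image_subset_iff.2 fun _ hj => entry_mem_Icc σ (filter_subset _ _ hj)

theorem doubleDescents_subset (σ : Equiv.Perm (Fin m)) : doubleDescents σ ⊆ Icc 1 m :=
  image_subset_iff.2 fun _ hj => entry_mem_Icc σ (filter_subset _ _ hj)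

theorem card_filter_lt_eq_sum {V : Finset ℕ} (hV : V ⊆ Icc 1 m) :
    (#{y ∈ V | y < x} : ℤ) = ∑ y ∈ Ico 1 x, if y ∈ V then 1 else 0 := by
  rw [sum_boole]
  congr 2
  ext y
  have := @hV y
  simp only [mem_filter, mem_Ico, mem_Icc] at this ⊢
  tauto

theorem gapsBelow_word_eq_height (σ : Equiv.Perm (Fin m)) (hx : x ≤ m + 1) :
    gapsBelow (word σ) x = height σ x := by
  rw [height, card_filter_lt_eq_sum (valleys_subset σ), card_filter_lt_eq_sum (peaks_subset σ),
    ← sum_sub_distrib, gapsBelow, add_comm]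
  congr 1
  refine sum_congr rfl fun y hy => ?_
  have hy' : y ∈ Icc 1 m := by
    rw [mem_Ico] at hy
    rw [mem_Icc]
    omega
  simp only [mem_valleys_iff hy', mem_peaks_iff hy']
  rcases (sides (word σ) y).1 with ⟨_ | _, _ | _⟩ <;> rfl

/-- The sets of valleys, of peaks and of double descents; they determine which neighbours of each
letter are larger than the letter. -/
def shape (σ : Equiv.Perm (Fin m)) : Finset ℕ × Finset ℕ × Finset ℕ :=
  (valleys σ, peaks σ, doubleDescents σ)

variable {τ : Equiv.Perm (Fin m)}

theorem height_congr (h : shape σ = shape τ) : height σ = height τ := by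
  obtain ⟨hV, hP⟩ : valleys σ = valleys τ ∧ peaks σ = peaks τ := by simp_all [shape]
  funext j
  rw [height, hV, hP, height]

theorem shape_eq_iff : shape σ = shape τ ↔
    ∀ x ∈ Icc 1 m, (sides (word σ) x).1 = (sides (word τ) x).1 := by
  have mem_congr {V W : Finset ℕ} (hV : V ⊆ Icc 1 m) (hW : W ⊆ Icc 1 m) :
      V = W ↔ ∀ x ∈ Icc 1 m, (x ∈ V ↔ x ∈ W) :=
    ⟨fun h _ _ => by rw [h], fun h => by
      ext x
      exact ⟨fun hx => (h x (hV hx)).1 hx, fun hx => (h x (hW hx)).2 hx⟩⟩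
  simp only [shape, Prod.mk.injEq, mem_congr (valleys_subset σ) (valleys_subset τ),
    mem_congr (peaks_subset σ) (peaks_subset τ),
    mem_congr (doubleDescents_subset σ) (doubleDescents_subset τ), ← forall₂_and]
  refine forall₂_congr fun x hx => ?_
  simp only [mem_valleys_iff hx, mem_peaks_iff hx, mem_doubleDescents_iff hx]
  rcases (sides (word σ) x).1 with ⟨_ | _, _ | _⟩ <;>
    rcases (sides (word τ) x).1 with ⟨_ | _, _ | _⟩ <;> simp

theorem disjoint_valleys_peaks (σ : Equiv.Perm (Fin m)) : Disjoint (valleys σ) (peaks σ) :=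
  disjoint_left.2 fun x hx hx' => by
    have hflags := (mem_valleys_iff (valleys_subset σ hx)).1 hx
    rw [(mem_peaks_iff (peaks_subset σ hx')).1 hx'] at hflags
    simp at hflags

theorem even_height_succ (hx : x ∈ valleys σ ∪ peaks σ) :
    Even (height σ (x + 1)) ↔ ¬ Even (height σ x) := by
  have hxm : x ∈ Icc 1 m := union_subset (valleys_subset σ) (peaks_subset σ) hx
  rw [← gapsBelow_word_eq_height σ (Nat.le_succ_of_le (mem_Icc.1 hxm).2),
    ← gapsBelow_word_eq_height σ (Nat.succ_le_succ (mem_Icc.1 hxm).2),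
    gapsBelow_succ (mem_Icc.1 hxm).1]
  obtain hx | hx := mem_union.1 hx
  · simp [(mem_valleys_iff hxm).1 hx]
  · simp [(mem_peaks_iff hxm).1 hx, Int.even_add]

theorem des_eq_card_valleys_union_doubleDescents (σ : Equiv.Perm (Fin m)) :
    des σ = #(valleys σ ∪ doubleDescents σ) := by
  have hunion : valleys σ ∪ doubleDescents σ =
      {j ∈ Icc 1 m | entry σ j < entry σ (j - 1)}.image (entry σ) := by
    rw [valleys, doubleDescents, ← image_union, ← filter_or]
    congr 1
    refine filter_congr fun j hj => ?_
    have hnext : entry σ (j + 1) ≠ entry σ j := entry_ne_entry hj (by simp)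
    grind
  have hzero := entry_zero σ
  rw [hunion, card_image_of_injOn fun i _ j hj h => eq_of_entry_eq σ (mem_of_mem_filter j hj) h]
  refine card_nbij' (· + 1) (· - 1) ?_ ?_ ?_ ?_
  all_goals
    simp only [Set.MapsTo, Set.LeftInvOn, descents, coe_filter, mem_Icc, mem_Ico,
      Set.mem_ofPred_eq]
    grind

variable [NeZero m]

theorem leftEmbracings_add_mirror (hx : x ∈ Icc 1 m) :
    (leftEmbracings σ x + leftEmbracings (mirror σ) x + 1 : ℤ) = height σ x := by
  rw [← gapsBelow_word_eq_height σ (Nat.le_succ_of_le (mem_Icc.1 hx).2),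
    ← (isOpenWord_word σ).embracings_add_one hx, sides_word_snd hx]

theorem height_last (σ : Equiv.Perm (Fin m)) : height σ (m + 1) = 0 := by
  rw [← gapsBelow_word_eq_height σ le_rfl, ← (isOpenWord_word σ).count_top,
    List.count_eq_zero_of_not_mem (top_notMem_word σ), Nat.cast_zero]

theorem eq_of_shape_eq (hshape : shape σ = shape τ)
    (hleft : ∀ x ∈ Icc 1 m, leftEmbracings σ x = leftEmbracings τ x) : σ = τ :=
  word_injective <| (isOpenWord_word σ).ext (isOpenWord_word τ) (shape_eq_iff.1 hshape)
    fun x hx => by rw [sides_word_snd hx, sides_word_snd hx, hleft x hx]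

theorem exists_shape_eq_leftEmbracings_eq (σ : Equiv.Perm (Fin m)) {l : ℕ → ℕ}
    (hl : ∀ x ∈ Icc 1 m, (l x : ℤ) < height σ x) :
    ∃ τ : Equiv.Perm (Fin m), shape τ = shape σ ∧ ∀ x ∈ Icc 1 m, leftEmbracings τ x = l x := by
  obtain ⟨w, hw, hsides⟩ := (isOpenWord_word σ).exists_sides_eq fun x hx => by
    rw [gapsBelow_word_eq_height σ (Nat.le_succ_of_le (mem_Icc.1 hx).2)]
    exact hl x hx
  have htop : w.count ⊤ = 0 := by
    have hgaps : gapsBelow w (m + 1) = gapsBelow (word σ) (m + 1) :=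
      gapsBelow_congr fun x hx => (hsides x (by simpa using hx)).1
    rw [← hw.count_top, gapsBelow_word_eq_height σ le_rfl, height_last] at hgaps
    exact_mod_cast hgaps
  obtain ⟨τ, rfl⟩ := exists_word_eq hw htop
  refine ⟨τ, shape_eq_iff.2 fun x hx => (hsides x hx).1, fun x hx => ?_⟩
  rw [← (hsides x hx).2, sides_word_snd hx]

theorem leftEmbracings_lt_height (hx : x ∈ Icc 1 m) : (leftEmbracings σ x : ℤ) < height σ x := by
  have := leftEmbracings_add_mirror (σ := σ) hx
  omega

theorem sum_shape_eq {M : Type*} [AddCommMonoid M] (σ : Equiv.Perm (Fin m))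
    (f : (Icc 1 m → ℕ) → M) :
    ∑ τ : Equiv.Perm (Fin m) with shape τ = shape σ, f (fun x => leftEmbracings τ x) =
      ∑ l ∈ Fintype.piFinset fun x : Icc 1 m => range (height σ x).toNat, f l := by
  refine sum_nbij (fun τ x => leftEmbracings τ x) ?_ ?_ ?_ (fun _ _ => rfl)
  · intro τ hτ
    rw [mem_filter_univ] at hτ
    rw [Fintype.mem_piFinset]
    intro x
    rw [mem_range, Int.lt_toNat, ← height_congr hτ]
    exact leftEmbracings_lt_height x.2
  · intro τ hτ τ' hτ' h
    rw [coe_filter_univ, Set.mem_ofPred_eq] at hτ hτ'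
    exact eq_of_shape_eq (hτ.trans hτ'.symm) fun x hx => congrFun h ⟨x, hx⟩
  · intro l hl
    simp only [Fintype.coe_piFinset, coe_range, Set.mem_univ_pi, Set.mem_Iio, Int.lt_toNat] at hl
    obtain ⟨τ, hτ, hleft⟩ := exists_shape_eq_leftEmbracings_eq σ
      (l := fun x => if hx : x ∈ Icc 1 m then l ⟨x, hx⟩ else 0)
      fun x hx => by simpa only [hx, dite_true] using hl ⟨x, hx⟩
    refine ⟨τ, by simpa using hτ, funext fun x => ?_⟩
    simp only [hleft x x.2, x.2, dite_true, Subtype.coe_eta]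

theorem res_eq_sum (σ : Equiv.Perm (Fin m)) :
    res σ = ∑ x ∈ Icc 1 m, ((height σ x).toNat - 1 - leftEmbracings σ x) := by
  rw [res_eq_les_mirror, les_eq_sum_leftEmbracings]
  refine sum_congr rfl fun x hx => ?_
  have := leftEmbracings_add_mirror (σ := σ) hx
  omega

theorem sum_shape_eq_mul_sum_even {R : Type*} [CommSemiring R] (p q : R) (σ : Equiv.Perm (Fin m))
    {M : Finset ℕ} (hM : M ⊆ Icc 1 m) (heven : ∀ x ∈ M, Even (height σ x)) :
    ∑ τ : Equiv.Perm (Fin m) with shape τ = shape σ, p ^ res τ * q ^ les τ =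
      (p + q) ^ #M * ∑ τ : Equiv.Perm (Fin m) with
        shape τ = shape σ ∧ ∀ x ∈ M, Even (leftEmbracings τ x), p ^ (res τ - #M) * q ^ les τ := by
  have hcard : #(M.subtype (· ∈ Icc 1 m)) = #M := by
    rw [card_subtype, filter_true_of_mem hM]
  have hforall (P : ℕ → Prop) : (∀ x ∈ M.subtype (· ∈ Icc 1 m), P x) ↔ ∀ x ∈ M, P x := by
    simpa using ⟨fun h x hx => h x (mem_Icc.1 (hM hx)).1 (mem_Icc.1 (hM hx)).2 hx,
      fun h x _ _ => h x⟩
  have hles (τ : Equiv.Perm (Fin m)) : les τ = ∑ x : Icc 1 m, leftEmbracings τ x := by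
    rw [les_eq_sum_leftEmbracings, sum_coe_sort]
  have hres {τ : Equiv.Perm (Fin m)} (hτ : shape τ = shape σ) :
      res τ = ∑ x : Icc 1 m, ((height σ x).toNat - 1 - leftEmbracings τ x) := by
    rw [res_eq_sum, height_congr hτ, ← sum_coe_sort]
  have hsum := sum_piFinset_range_eq_mul_sum_even p q (A := fun x : Icc 1 m => (height σ x).toNat)
    ((hforall fun x => Even (height σ x).toNat).2 fun x hx => even_toNat (heven x hx))
  rw [sum_filter, ← sum_shape_eq, ← sum_shape_eq, hcard] at hsum
  rw [← filter_filter, sum_filter fun τ => ∀ x ∈ M, Even (leftEmbracings τ x)]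
  refine (sum_congr rfl fun τ hτ => ?_).trans <| hsum.trans <| congrArg _ <|
    sum_congr rfl fun τ hτ => ?_
  · rw [hres ((mem_filter_univ τ).1 hτ), hles]
  · rw [hres ((mem_filter_univ τ).1 hτ), hles]
    simp only [hforall fun x => Even (leftEmbracings τ x)]

theorem card_le_res {M : Finset ℕ} (hM : M ⊆ Icc 1 m) (heven : ∀ x ∈ M, Even (height σ x))
    (hleft : ∀ x ∈ M, Even (leftEmbracings σ x)) : #M ≤ res σ := by
  rw [res_eq_sum]
  refine card_le_sum_sub_of_even hM (fun x hx => even_toNat (heven x hx)) hleft fun x hx => ?_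
  rw [Int.lt_toNat]
  exact leftEmbracings_lt_height (hM hx)

theorem self_mem_peaks (σ : Equiv.Perm (Fin m)) : m ∈ peaks σ := by
  obtain ⟨j, hj, hjm⟩ := exists_entry_eq σ (right_mem_Icc.2 NeZero.one_le : m ∈ Icc 1 m)
  have hlt {i : ℕ} (hij : i ≠ j) : entry σ i < entry σ j := by
    refine (entry_ne_entry hj hij).lt_of_le ?_
    by_cases hi : i ∈ Icc 1 m
    · exact (mem_Icc.1 (entry_mem_Icc σ hi)).2.trans_eq hjm.symm
    · simp [entry, show ¬(1 ≤ i ∧ i ≤ m) by simpa using hi]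
  refine mem_image.2 ⟨j, mem_filter.2 ⟨hj, hlt ?_, hlt ?_⟩, hjm⟩ <;> grind

theorem card_peaks_eq (σ : Equiv.Perm (Fin m)) : #(peaks σ) = #(valleys σ) + 1 := by
  have hlast := height_last σ
  rw [height, filter_true_of_mem fun x hx => Nat.lt_succ_of_le (mem_Icc.1 (valleys_subset σ hx)).2,
    filter_true_of_mem fun x hx => Nat.lt_succ_of_le (mem_Icc.1 (peaks_subset σ hx)).2] at hlast
  omega

end Permutation

section FPermutation

variable {n k : ℕ} {σ τ : Equiv.Perm (Fin (2 * n + 1))}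

theorem IsF.odd_of_mem_valleys_union_peaks (hσ : IsF n σ) {x : ℕ}
    (hx : x ∈ valleys σ ∪ peaks σ) : Odd x := by
  obtain ⟨⟨hdescent, hend⟩, -, -⟩ := hσ
  obtain hx | hx := mem_union.1 hx
  · obtain ⟨j, hj, rfl⟩ := mem_image.1 hx
    obtain ⟨hj, hprev, -⟩ := mem_filter.1 hj
    have hj0 : j - 1 ≠ 0 := fun h => by simp [h, entry_zero] at hprev
    rw [mem_Icc] at hj
    obtain ⟨i, rfl⟩ := Nat.exists_eq_add_of_le' hj.1
    exact (hdescent i (mem_filter.2 ⟨mem_Ico.2 (by omega), hprev⟩)).2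
  · obtain ⟨j, hj, rfl⟩ := mem_image.1 hx
    obtain ⟨hj, -, hnext⟩ := mem_filter.1 hj
    rw [mem_Icc] at hj
    obtain hlt | rfl := hj.2.lt_or_eq
    · exact (hdescent j (mem_filter.2 ⟨mem_Ico.2 ⟨hj.1, hlt⟩, hnext⟩)).1
    · exact hend

theorem isF_of_odd (hdd : doubleDescents σ = ∅) (hodd : ∀ x ∈ valleys σ ∪ peaks σ, Odd x) :
    IsF n σ := by
  have hrise {j : ℕ} (hj : j ∈ Icc 1 (2 * n + 1)) (hprev : entry σ j < entry σ (j - 1)) :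
      entry σ j < entry σ (j + 1) := by
    have hj' : entry σ j ∉ doubleDescents σ := by simp [hdd]
    rw [doubleDescents, entry_mem_image_filter_iff σ hj, not_and, not_lt] at hj'
    exact (hj' hprev).lt_of_ne (entry_ne_entry hj j.lt_succ_self.ne').symm
  have hvalley {j : ℕ} (hj : j ∈ Icc 1 (2 * n + 1)) (hprev : entry σ j < entry σ (j - 1)) :
      Odd (entry σ j) :=
    hodd _ (mem_union_left _ (mem_image_of_mem _ (mem_filter.2 ⟨hj, hprev, hrise hj hprev⟩)))
  have hclimb {j : ℕ} (hj : j ∈ Icc 1 (2 * n + 1)) (hnext : entry σ (j + 1) < entry σ j) :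
      entry σ (j - 1) < entry σ j :=
    (entry_ne_entry hj (by grind)).lt_of_le (not_lt.1 fun h => (hrise hj h).not_gt hnext)
  have hpeak {j : ℕ} (hj : j ∈ Icc 1 (2 * n + 1)) (hnext : entry σ (j + 1) < entry σ j) :
      Odd (entry σ j) :=
    hodd _ (mem_union_right _ (mem_image_of_mem _ (mem_filter.2 ⟨hj, hclimb hj hnext, hnext⟩)))
  have hlast : 2 * n + 1 ∈ Icc 1 (2 * n + 1) := right_mem_Icc.2 (Nat.le_add_left _ _)
  have hend : entry σ (2 * n + 1 + 1) < entry σ (2 * n + 1) := by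
    rw [entry_of_lt σ (Nat.lt_succ_self _)]
    exact (mem_Icc.1 (entry_mem_Icc σ hlast)).1
  refine ⟨⟨fun i hi => ?_, hpeak hlast hend⟩, hdd, hclimb hlast hend⟩
  obtain ⟨hi, hdescent⟩ := mem_filter.1 hi
  rw [mem_Ico] at hi
  exact ⟨hpeak (mem_Icc.2 (by omega)) hdescent, hvalley (mem_Icc.2 (by omega)) hdescent⟩

theorem isF_iff :
    IsF n σ ↔ doubleDescents σ = ∅ ∧ ∀ x ∈ valleys σ ∪ peaks σ, Odd x :=
  ⟨fun h => ⟨h.2.1, fun _ => h.odd_of_mem_valleys_union_peaks⟩, fun h => isF_of_odd h.1 h.2⟩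

/-- The element of the pair `{2i - 1, 2i}` whose left-embracings form the embracing number of the
pair. -/
def pivot (n : ℕ) (σ : Equiv.Perm (Fin (2 * n + 1))) (i : ℕ) : ℕ :=
  if Even (height σ (2 * i - 1)) then 2 * i - 1 else 2 * i

/-- The pivots of the VOP pairs. -/
def pivots (n : ℕ) (σ : Equiv.Perm (Fin (2 * n + 1))) : Finset ℕ :=
  {i ∈ Icc 1 n | IsVOP σ i}.image (pivot n σ)

theorem pivots_subset : pivots n σ ⊆ Icc 1 (2 * n + 1) :=
  image_subset_iff.2 fun i hi => by
    have := mem_Icc.1 (mem_of_mem_filter i hi)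
    rw [mem_Icc, pivot]
    grind

theorem even_height_of_mem_pivots {x : ℕ} (hx : x ∈ pivots n σ) : Even (height σ x) := by
  obtain ⟨i, hi, rfl⟩ := mem_image.1 hx
  obtain ⟨hi, hvop⟩ := mem_filter.1 hi
  rw [pivot]
  split_ifs with heven
  · exact heven
  · rw [show 2 * i = 2 * i - 1 + 1 by grind]
    exact (even_height_succ (mem_union.2 hvop)).2 heven

theorem isNormalizedF_iff :
    IsNormalizedF n σ ↔ IsF n σ ∧ ∀ x ∈ pivots n σ, Even (leftEmbracings σ x) := by
  simp only [IsNormalizedF, pivots, forall_mem_image, mem_filter, and_imp, pivot, pairEmbracing,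
    apply_ite (leftEmbracings σ)]

theorem card_pivots (hσ : σ ∈ FPerms n k) : #(pivots n σ) = 2 * k := by
  obtain ⟨hF, rfl⟩ := (mem_filter_univ σ).1 hσ
  obtain ⟨hdd, hodd⟩ := isF_iff.1 hF
  have hinj : Set.InjOn (pivot n σ) ({i ∈ Icc 1 n | IsVOP σ i} : Finset ℕ) := by
    intro i hi j hj h
    simp only [coe_filter, mem_Icc, Set.mem_ofPred_eq, pivot] at hi hj h
    grind
  have hvop : #{i ∈ Icc 1 n | IsVOP σ i} = #((valleys σ ∪ peaks σ).erase (2 * n + 1)) := by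
    have hle {x : ℕ} (hx : x ∈ valleys σ ∪ peaks σ) : x ≤ 2 * n + 1 :=
      (mem_Icc.1 (union_subset (valleys_subset σ) (peaks_subset σ) hx)).2
    refine card_nbij' (fun i => 2 * i - 1) (fun x => (x + 1) / 2) ?_ ?_ ?_ ?_
    all_goals
      simp only [Set.MapsTo, Set.LeftInvOn, coe_filter, coe_erase, mem_Icc, Set.mem_ofPred_eq,
        IsVOP, ← mem_union, Set.mem_sdiff, mem_coe, Set.mem_singleton_iff]
      grind
  rw [pivots, card_image_of_injOn hinj, hvop,
    card_erase_of_mem (mem_union_right _ (self_mem_peaks σ)),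
    card_union_of_disjoint (disjoint_valleys_peaks σ), card_peaks_eq,
    des_eq_card_valleys_union_doubleDescents, hdd, union_empty]
  omega

theorem pivots_congr (h : shape σ = shape τ) : pivots n σ = pivots n τ := by
  have hpivot : pivot n σ = pivot n τ := by
    funext i
    rw [pivot, height_congr h, pivot]
  simp only [shape, Prod.mk.injEq] at h
  simp only [pivots, hpivot, IsVOP, h]

theorem mem_FPerms_congr (h : shape σ = shape τ) : σ ∈ FPerms n k ↔ τ ∈ FPerms n k := by
  simp only [shape, Prod.mk.injEq] at h
  simp only [FPerms, mem_filter_univ, isF_iff, des_eq_card_valleys_union_doubleDescents, h]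

theorem mem_normalizedFPerms_iff : σ ∈ normalizedFPerms n k ↔
    σ ∈ FPerms n k ∧ ∀ x ∈ pivots n σ, Even (leftEmbracings σ x) := by
  simp only [normalizedFPerms, FPerms, mem_filter_univ, isNormalizedF_iff]
  tauto

theorem filter_FPerms_shape_eq (hσ : σ ∈ FPerms n k) :
    {τ ∈ FPerms n k | shape τ = shape σ} =
      ({τ | shape τ = shape σ} : Finset (Equiv.Perm (Fin (2 * n + 1)))) := by
  ext τ
  rw [mem_filter, mem_filter_univ, and_iff_right_iff_imp]
  exact fun h => (mem_FPerms_congr h).2 hσ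

theorem filter_normalizedFPerms_shape_eq (hσ : σ ∈ FPerms n k) :
    {τ ∈ normalizedFPerms n k | shape τ = shape σ} =
      ({τ | shape τ = shape σ ∧ ∀ x ∈ pivots n σ, Even (leftEmbracings τ x)} :
        Finset (Equiv.Perm (Fin (2 * n + 1)))) := by
  ext τ
  rw [mem_filter, mem_filter_univ, mem_normalizedFPerms_iff, and_comm, and_congr_right_iff]
  intro h
  rw [pivots_congr h, mem_FPerms_congr h, and_iff_right hσ]

end FPermutation

end OddOdd

theorem mainTheorem7 (n k : ℕ) :
    (∀ σ ∈ OddOdd.normalizedFPerms n k, 2 * k ≤ OddOdd.res σ) ∧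
    ∀ {R : Type*} [CommSemiring R] (p q : R),
      OddOdd.gammaCoeff n k 1 p q =
        (p + q) ^ (2 * k) *
          ∑ σ ∈ OddOdd.normalizedFPerms n k, p ^ (OddOdd.res σ - 2 * k) * q ^ OddOdd.les σ := by
  open OddOdd Finset in
  refine ⟨fun σ hσ => ?_, fun p q => ?_⟩
  · obtain ⟨hF, heven⟩ := mem_normalizedFPerms_iff.1 hσ
    rw [← card_pivots hF]
    exact card_le_res pivots_subset (fun _ => even_height_of_mem_pivots) heven
  · have hshape : ∀ σ ∈ FPerms n k, shape σ ∈ (FPerms n k).image shape := fun _ =>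
      mem_image_of_mem shape
    rw [gammaCoeff, ← sum_fiberwise_of_maps_to hshape, ← sum_fiberwise_of_maps_to
      fun σ hσ => hshape σ (mem_normalizedFPerms_iff.1 hσ).1, mul_sum]
    refine sum_congr rfl (forall_mem_image.2 fun σ hσ => ?_)
    rw [filter_FPerms_shape_eq hσ, filter_normalizedFPerms_shape_eq hσ, ← card_pivots hσ,
      ← sum_shape_eq_mul_sum_even p q σ pivots_subset fun _ => even_height_of_mem_pivots]
    simp only [one_pow, one_mul]
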